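/- Let $(\Omega,\mathcal F,\mathbb P)$ be a probability space, $(\mathcal F_n)_{n\ge 0}$ an increasing sequence of sub-$\sigma$-algebras of $\mathcal F$, and $\mathbb E_n$ the conditional expectation with respect to $\mathcal F_n$, defined for every nonnegative measurable function (with values in $[0,\infty]$) and, by $\mathbb E_n(f)=\mathbb E_n(f^+)-\mathbb E_n(f^-)$, for every real measurable $f$ with $\mathbb E_n(|f|)<\infty$ almost everywhere. Put $M(f):=\sup_{n\ge 0}|\mathbb E_n(f)|$. Let $\varphi:\Omega\times[0,\infty)\to[0,\infty)$ be a Musielak--Orlicz function: for every $x\in\Omega$ the function $\varphi(x,\cdot)$ is non-decreasing, $\varphi(x,0)=0$ and $\lim_{t\to\infty}\varphi(x,t)=\infty$; and $\varphi(\cdot,t)$ is measurable for every $t\in[0,\infty)$. Let $L^\varphi(\Omega)$ be the set of all measurable $f:\Omega\to\mathbb R$ with $$\|f\|_{L^\varphi(\Omega)}:=\inf\Big\{\lambda\in(0,\infty):\ \int_\Omega\varphi(x,|f(x)|/\lambda)\,d\mathbb P(x)\le 1\Big\}<\infty$$ (with $\inf\emptyset=\infty$; if an integrand is not measurable, the integral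 is the lower integral, that is, the supremum of the integrals of the nonnegative measurable functions below it). For $q\in[1,\infty)$ write $\varphi\in A_q(\Omega)$ if $\varphi(x,t)>0$ for all $x\in\Omega$ and $t>0$, and there is a constant $K\in(0,\infty)$ such that, for all $t\in(0,\infty)$ and $n\ge 0$, almost everywhere, $$\mathbb E_n(\varphi(\cdot,t))\,\big[\mathbb E_n\big(\varphi(\cdot,t)^{-1/(q-1)}\big)\big]^{q-1}\le K\ \text{ if } q>1,\qquad \mathbb E_n(\varphi(\cdot,t))\,\frac1{\varphi(\cdot,t)}\le K\ \text{ if } q=1.$$ Put $A_\infty(\Omega):=\bigcup_{q\in[1,\infty)}A_q(\Omega)$ and $q(\varphi):=\inf\{q\in[1,\infty):\varphi\in A_q(\Omega)\}$. For $p\in(0,\infty)$, $\varphi$ is of uniformly lower (resp. upper) type $p$ if there is a constant $C_{(p)}\in(0,\infty)$ such that $\varphi(x,st)\le C_{(p)}s^p\varphi(x,t)$ for all $x\in\Omega$, $t\in[0,\infty)$ and $s\in(0,1)$ (resp. $s\in[1,\infty)$). **Theorem (Doob maximal inequality on $L^\varphi$).** Let $\varphi\in A_\infty(\Omega)$ be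 a Musielak--Orlicz function of uniformly lower type $p_\varphi^-$ and uniformly upper type $p_\varphi^+$ with $$q(\varphi)<p_\varphi^-\le p_\varphi^+<\infty.$$ Then, for every $f\in L^\varphi(\Omega)$, $\mathbb E_n(|f|)<\infty$ almost everywhere for all $n$, so that $M(f)$ is well defined, and $M(f)<\infty$ almost everywhere. Moreover, the Doob maximal operator $M$ is bounded on $L^\varphi(\Omega)$: there is a constant $C\in(0,\infty)$ such that $\|M(f)\|_{L^\varphi(\Omega)}\le C\|f\|_{L^\varphi(\Omega)}$ for all $f\in L^\varphi(\Omega)$; and there is a constant $C\in(0,\infty)$ such that, for all $f\in L^\varphi(\Omega)$, $$\int_\Omega\varphi(x,M(f)(x))\,d\mathbb P(x)\le C\int_\Omega\varphi(x,|f(x)|)\,d\mathbb P(x).$$ -/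

import Mathlib

open MeasureTheory Filter
open scoped NNReal ENNReal

namespace MusielakOrlicz

/-- `φ : Ω × [0,∞) → [0,∞)` is a Musielak–Orlicz function: `φ(x,·)` is an Orlicz function
for every `x`, and `φ(·,t)` is measurable for every `t`. -/
structure IsMusielakOrlicz {Ω : Type*} [MeasurableSpace Ω] (φ : Ω → ℝ≥0 → ℝ≥0) : Prop where
  mono : ∀ x, Monotone (φ x)
  zero : ∀ x, φ x 0 = 0
  tendsto : ∀ x, Tendsto (φ x) atTop atTop
  measurable : ∀ t, Measurable fun x => φ x t

/-- Uniformly lower type `p`. -/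
def HasLowerType {Ω : Type*} (φ : Ω → ℝ≥0 → ℝ≥0) (p : ℝ) : Prop :=
  0 < p ∧ ∃ C : ℝ≥0, 0 < C ∧ ∀ (x : Ω) (t s : ℝ≥0), 0 < s → s < 1 →
    φ x (s * t) ≤ C * s ^ p * φ x t

/-- Uniformly upper type `p`. -/
def HasUpperType {Ω : Type*} (φ : Ω → ℝ≥0 → ℝ≥0) (p : ℝ) : Prop :=
  0 < p ∧ ∃ C : ℝ≥0, 0 < C ∧ ∀ (x : Ω) (t s : ℝ≥0), 1 ≤ s →
    φ x (s * t) ≤ C * s ^ p * φ x t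

/-- The modular `∫ φ(x, |f(x)|) dμ(x)`, with values in `[0,∞]`. -/
noncomputable def modular {Ω : Type*} [MeasurableSpace Ω] (μ : Measure Ω)
    (φ : Ω → ℝ≥0 → ℝ≥0) (f : Ω → ℝ) : ℝ≥0∞ :=
  ∫⁻ x, (φ x ‖f x‖₊ : ℝ≥0∞) ∂μ

/-- The Luxemburg norm, with values in `[0,∞]` (it is `∞` if no `c` is admissible). -/
noncomputable def luxNorm {Ω : Type*} [MeasurableSpace Ω] (μ : Measure Ω)
    (φ : Ω → ℝ≥0 → ℝ≥0) (f : Ω → ℝ) : ℝ≥0∞ :=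
  ⨅ (c : ℝ≥0) (_ : 0 < c ∧ modular μ φ (fun x => f x / c) ≤ 1), (c : ℝ≥0∞)

/-- Membership in the Musielak–Orlicz space `L^φ`. -/
def MemLphi {Ω : Type*} [MeasurableSpace Ω] (μ : Measure Ω)
    (φ : Ω → ℝ≥0 → ℝ≥0) (f : Ω → ℝ) : Prop :=
  Measurable f ∧ luxNorm μ φ f < ∞

/-- `φ` satisfies the uniform `A_q` condition with respect to the filtration `ℱ`
(`1 ≤ q < ∞`). Conditional expectations of nonnegative functions take values in `[0,∞]`. -/
def IsAq {Ω : Type*} {m0 : MeasurableSpace Ω} (μ : Measure Ω) (ℱ : Filtration ℕ m0)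
    (φ : Ω → ℝ≥0 → ℝ≥0) (q : ℝ) : Prop :=
  1 ≤ q ∧ (∀ (x : Ω) (t : ℝ≥0), 0 < t → 0 < φ x t) ∧
  ∃ K : ℝ≥0, 0 < K ∧
    (1 < q → ∀ (n : ℕ) (t : ℝ≥0), 0 < t → ∀ᵐ x ∂μ,
      (μ⁻[fun y => (φ y t : ℝ≥0∞)|ℱ n]) x *
        ((μ⁻[fun y => (φ y t : ℝ≥0∞) ^ (-(1 / (q - 1)))|ℱ n]) x) ^ (q - 1) ≤ K) ∧
    (q = 1 → ∀ (n : ℕ) (t : ℝ≥0), 0 < t → ∀ᵐ x ∂μ,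
      (μ⁻[fun y => (φ y t : ℝ≥0∞)|ℱ n]) x * (φ x t : ℝ≥0∞)⁻¹ ≤ K)

/-- `φ ∈ A_∞`. -/
def IsAinfty {Ω : Type*} {m0 : MeasurableSpace Ω} (μ : Measure Ω) (ℱ : Filtration ℕ m0)
    (φ : Ω → ℝ≥0 → ℝ≥0) : Prop :=
  ∃ q : ℝ, IsAq μ ℱ φ q

/-- The critical index `q(φ) = inf {q ∈ [1,∞) : φ ∈ A_q}`. -/
noncomputable def criticalIndex {Ω : Type*} {m0 : MeasurableSpace Ω} (μ : Measure Ω)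
    (ℱ : Filtration ℕ m0) (φ : Ω → ℝ≥0 → ℝ≥0) : ℝ :=
  sInf {q : ℝ | IsAq μ ℱ φ q}

/-- The conditional expectation `E(f⁺|m) - E(f⁻|m)` of a real function `f`; it is well defined
(almost everywhere) as soon as `E(|f| | m) < ∞` almost everywhere. For integrable `f` it is the
usual conditional expectation, but elements of `L^φ` need not be integrable. -/
noncomputable def genCondExp {Ω : Type*} {m0 : MeasurableSpace Ω} (μ : Measure Ω)
    (m : MeasurableSpace Ω) (f : Ω → ℝ) (x : Ω) : ℝ :=
  ((μ⁻[fun y => ENNReal.ofReal (f y)|m]) x).toReal -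
    ((μ⁻[fun y => ENNReal.ofReal (-f y)|m]) x).toReal

/-- The Doob maximal function `M(f) = sup_n |E_n(f)|`, with values in `[0,∞]`. -/
noncomputable def doobMax {Ω : Type*} {m0 : MeasurableSpace Ω} (μ : Measure Ω)
    (ℱ : Filtration ℕ m0) (f : Ω → ℝ) (x : Ω) : ℝ≥0∞ :=
  ⨆ n : ℕ, ‖genCondExp μ (ℱ n) f x‖ₑ

end MusielakOrlicz

namespace MusielakOrlicz

/-! Since the critical index lies strictly below the lower type p, φ satisfies A_q for some q with 1
< q < p, so neither self-improvement of weights nor interpolation is needed. Each w = φ(·, l) is an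
A_q weight with constant independent of l, and this gives a truncated weak-type bound for g = |f|
(`lintegral_le_of_weak_type`): l^q w{Mg > 2l} ≲ ∫_{g > l} g^q w. Divide by l^q and sum over l = 2^k.
On the left, the sum of φ(x, 2^k) over 2^{k+1} < Mg(x) dominates φ(x, Mg(x)) by the upper type
(`le_dyadicSum`). On the right, the lower type bounds (g/2^k)^q φ(x, 2^k) by c (2^k/g)^{p-q} φ(x,
g), a geometric series because q < p (`tsum_levels_le`). This is the modular inequality. The dyadic
sum is infinite wherever Mg is, which yields finiteness; homogeneity of M and the lower type turn
the modular bound into the norm bound. -/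

/-! ### Conditional expectations and A_q weights -/

theorem condLExp_ae_ne_zero {Ω : Type*} {m m0 : MeasurableSpace Ω} (hm : m ≤ m0)
    (μ : Measure Ω) [SigmaFinite (μ.trim hm)] {f : Ω → ℝ≥0∞} (hf : Measurable f)
    (h0 : ∀ x, f x ≠ 0) : ∀ᵐ x ∂μ, (μ⁻[f|m]) x ≠ 0 := by
  have hZ : MeasurableSet[m] {x | (μ⁻[f|m]) x = 0} :=
    measurable_condLExp m μ f (measurableSet_singleton 0)
  have h : ∫⁻ x in {x | (μ⁻[f|m]) x = 0}, f x ∂μ = 0 := by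
    rw [← setLIntegral_condLExp hm μ f hZ]
    exact (setLIntegral_congr_fun (g := fun _ => 0) (hm _ hZ) fun x hx => hx).trans (by simp)
  rw [lintegral_eq_zero_iff hf, EventuallyEq, ae_restrict_iff' (hm _ hZ)] at h
  filter_upwards [h] with x hx hx0
  exact h0 x (hx hx0)

/-- `A_1 ⊆ A_q`. -/
theorem IsAq.of_one {Ω : Type*} {m0 : MeasurableSpace Ω} {μ : Measure Ω} [IsProbabilityMeasure μ]
    {ℱ : Filtration ℕ m0} {φ : Ω → ℝ≥0 → ℝ≥0} (h : IsAq μ ℱ φ 1)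
    {q : ℝ} (hq : 1 < q) : IsAq μ ℱ φ q := by
  obtain ⟨-, hpos, K, hK, -, h1⟩ := h
  refine ⟨hq.le, hpos, K, hK, fun _ n t ht => ?_, fun h => absurd h hq.ne'⟩
  have hq' : 0 < q - 1 := sub_pos.2 hq
  set W := μ⁻[fun y => (φ y t : ℝ≥0∞)|ℱ n]
  -- A_1 says φ ≥ W / K, so the negative power of φ is dominated by V, which is `ℱ n`-measurable and
  -- hence fixed by the conditional expectation.
  set V : Ω → ℝ≥0∞ := fun x => (W x / K) ^ (-(1 / (q - 1))) with hV
  have hWm : Measurable[ℱ n] W := measurable_condLExp _ _ _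
  have hVm : Measurable[ℱ n] V := (hWm.div_const _).pow_const _
  have hle : (fun y => (φ y t : ℝ≥0∞) ^ (-(1 / (q - 1)))) ≤ᵐ[μ] V := by
    filter_upwards [h1 rfl n t ht] with x hx
    have hφ0 : (φ x t : ℝ≥0∞) ≠ 0 := by simpa using (hpos x t ht).ne'
    have : W x / K ≤ φ x t := by
      rw [← div_eq_mul_inv] at hx
      have := (ENNReal.div_le_iff hφ0 ENNReal.coe_ne_top).1 hx
      exact ENNReal.div_le_of_le_mul' this
    simp only [hV, ENNReal.rpow_neg]
    gcongr
  have hmono := condLExp_mono (mΩ := ℱ n) hle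
  rw [condLExp_eq_self (ℱ.le n) μ hVm] at hmono
  filter_upwards [hmono] with x hx
  calc W x * _ ≤ W x * (V x) ^ (q - 1) := by gcongr
    _ = W x * (W x / K)⁻¹ := by
      simp only [hV]
      rw [← ENNReal.rpow_mul, neg_mul, one_div, inv_mul_cancel₀ hq'.ne', ENNReal.rpow_neg_one]
    _ ≤ K := by
      rw [ENNReal.inv_div (Or.inl ENNReal.coe_ne_top) (Or.inl (by simpa using hK.ne'))]
      exact ENNReal.mul_div_le

/-! ### Truncated weak-type inequality -/

/-- A Young-type splitting that replaces conditional Hölder: it is linear in the three terms, so it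
passes to conditional expectations. If g exceeds a w^{-1/(q-1)}, raising to the power q - 1 gives
a^{q-1} ≤ g^{q-1} w, which bounds g by the last term. -/
theorem le_add_add_indicator {q : ℝ} (hq : 1 < q) (g l a w : ℝ≥0) (ha : 0 < a) (hw : 0 < w) :
    g ≤ l + a * w ^ (-(1 / (q - 1))) + a ^ (1 - q) * (if l < g then g ^ q * w else 0) := by
  have hq' : 0 < q - 1 := sub_pos.2 hq
  split_ifs with hl
  · rcases le_or_gt g (a * w ^ (-(1 / (q - 1)))) with h | h
    · exact h.trans (le_add_right le_add_self)
    · refine le_trans ?_ le_add_self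
      have h1 := NNReal.rpow_le_rpow h.le hq'.le
      rw [NNReal.mul_rpow, ← NNReal.rpow_mul, neg_mul, one_div, inv_mul_cancel₀ hq'.ne',
        NNReal.rpow_neg_one, ← div_eq_mul_inv, div_le_iff₀ hw] at h1
      have hg : g ≠ 0 := (bot_le.trans_lt hl).ne'
      have e1 : a ^ (1 - q) * a ^ (q - 1) = 1 := by
        rw [← NNReal.rpow_add ha.ne']; simp
      have e2 : g ^ q = g * g ^ (q - 1) := by
        conv_rhs => rw [← NNReal.rpow_one_add' (by simpa using (by linarith : q ≠ 0))]
        simp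
      calc g = a ^ (1 - q) * (g * a ^ (q - 1)) := by rw [mul_left_comm, e1, mul_one]
        _ ≤ a ^ (1 - q) * (g * (g ^ (q - 1) * w)) := by gcongr
        _ = _ := by rw [e2]; ring
  · exact (not_lt.1 hl).trans (le_add_right (le_add_right le_rfl))

/-- The conditional Hölder estimate behind the weak-type inequality, for one point. -/
theorem rpow_mul_le_of_forall_zpow {q : ℝ} (hq : 1 < q) {K l : ℝ≥0} (hl : 0 < l) {S W Y : ℝ≥0∞}
    (hS : S ≠ 0) (hW : W ≠ 0) (hWS : W * S ^ (q - 1) ≤ K)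
    (h : ∀ k : ℤ, 2 * (l : ℝ≥0∞) ≤
      l + ((2 ^ k : ℝ≥0) : ℝ≥0∞) * S + (((2 ^ k : ℝ≥0) ^ (1 - q) : ℝ≥0) : ℝ≥0∞) * Y) :
    ((l ^ q : ℝ≥0) : ℝ≥0∞) * W ≤ ((2 * 4 ^ (q - 1) * K : ℝ≥0) : ℝ≥0∞) * Y := by
  have hq' : 0 < q - 1 := sub_pos.2 hq
  have hS' : S ^ (q - 1) ≠ 0 := by simp [hS, hq'.not_gt]
  have hSt : S ≠ ∞ := by
    rintro rfl
    rw [ENNReal.top_rpow_of_pos hq', ENNReal.mul_top hW] at hWS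
    exact ENNReal.coe_ne_top (top_le_iff.1 hWS)
  have hWt : W ≠ ∞ := by
    rintro rfl
    rw [ENNReal.top_mul hS'] at hWS
    exact ENNReal.coe_ne_top (top_le_iff.1 hWS)
  have hK : K ≠ 0 := by
    rintro rfl
    exact mul_ne_zero hW hS' (le_antisymm (by simpa using hWS) bot_le)
  rcases eq_or_ne Y ∞ with rfl | hY
  · rw [ENNReal.mul_top]
    · exact le_top
    · simp only [ne_eq, ENNReal.coe_eq_zero]
      positivity
  lift S to ℝ≥0 using hSt
  lift W to ℝ≥0 using hWt
  lift Y to ℝ≥0 using hY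
  rw [← ENNReal.coe_rpow_of_nonneg _ hq'.le] at hWS
  norm_cast at h hWS hS ⊢
  -- Near-optimal parameter: l/(4S) ≤ 2^k ≤ l/(2S). The upper bound absorbs the S term into l/2; the
  -- lower bound costs the factor 4^{q-1}.
  obtain ⟨k, hk1, hk2⟩ := NNReal.exists_mem_Ico_zpow (x := l / (2 * S)) (y := 2)
    (by positivity) (by norm_num)
  set a : ℝ≥0 := 2 ^ k with ha
  have ha0 : 0 < a := by positivity
  have hk2' : l / (4 * S) ≤ a := by
    rw [zpow_add₀ two_ne_zero, zpow_one, ← ha] at hk2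
    rw [div_le_iff₀ (by positivity)]
    rw [div_lt_iff₀ (by positivity)] at hk2
    calc l ≤ a * 2 * (2 * S) := hk2.le
      _ = _ := by ring
  have h1 : a * S ≤ l / 2 := by
    rw [le_div_iff₀ (by positivity)] at hk1
    rw [le_div_iff₀ (by positivity)]
    calc a * S * 2 = a * (2 * S) := by ring
      _ ≤ l := hk1
  have h2 : l / 2 ≤ a ^ (1 - q) * Y := by
    have h3 := h k
    rw [← ha] at h3
    have h4 : (2 : ℝ) * l ≤ l + a * S + (a ^ (1 - q) * Y : ℝ≥0) := by exact_mod_cast h3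
    have h5 : (a : ℝ) * S ≤ l / 2 := by exact_mod_cast h1
    have h6 : (l : ℝ) / 2 ≤ (a ^ (1 - q) * Y : ℝ≥0) := by linarith
    exact_mod_cast h6
  have e1 : a ^ (q - 1) * a ^ (1 - q) = 1 := by
    rw [← NNReal.rpow_add ha0.ne']; simp
  have e2 : l ^ q = l * l ^ (q - 1) := by
    conv_rhs => rw [← NNReal.rpow_one_add' (by simpa using (by linarith : q ≠ 0))]
    simp
  have h7 : (l / (4 * S)) ^ (q - 1) * (l / 2) ≤ Y := by
    calc _ ≤ a ^ (q - 1) * (a ^ (1 - q) * Y) := by gcongr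
      _ = Y := by rw [← mul_assoc, e1, one_mul]
  have h4 : (4 : ℝ≥0) ^ (q - 1) ≠ 0 := by positivity
  have h5 : S ^ (q - 1) ≠ 0 := by positivity
  calc l ^ q * W = 2 * 4 ^ (q - 1) * (W * S ^ (q - 1)) * ((l / (4 * S)) ^ (q - 1) * (l / 2)) := by
        rw [NNReal.div_rpow, NNReal.mul_rpow, e2]
        field_simp
    _ ≤ 2 * 4 ^ (q - 1) * K * Y := by gcongr

theorem ae_rpow_mul_condLExp_le {Ω : Type*} {m m0 : MeasurableSpace Ω} (hm : m ≤ m0)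
    {μ : Measure Ω} [SigmaFinite (μ.trim hm)] {q : ℝ} (hq : 1 < q) {K l : ℝ≥0} (hl : 0 < l)
    {w g : Ω → ℝ≥0} (hw : Measurable w) (hw0 : ∀ x, 0 < w x) (hg : Measurable g)
    (hA : ∀ᵐ x ∂μ, (μ⁻[fun y => (w y : ℝ≥0∞)|m]) x *
      ((μ⁻[fun y => (w y : ℝ≥0∞) ^ (-(1 / (q - 1)))|m]) x) ^ (q - 1) ≤ K) :
    ∀ᵐ x ∂μ, 2 * (l : ℝ≥0∞) < (μ⁻[fun y => (g y : ℝ≥0∞)|m]) x →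
      ((l ^ q : ℝ≥0) : ℝ≥0∞) * (μ⁻[fun y => (w y : ℝ≥0∞)|m]) x ≤
        ((2 * 4 ^ (q - 1) * K : ℝ≥0) : ℝ≥0∞) *
          (μ⁻[fun y => ((if l < g y then g y ^ q * w y else 0 : ℝ≥0) : ℝ≥0∞)|m]) x := by
  set σ : Ω → ℝ≥0∞ := fun y => (w y : ℝ≥0∞) ^ (-(1 / (q - 1))) with hσ
  set u : Ω → ℝ≥0∞ := fun y => ((if l < g y then g y ^ q * w y else 0 : ℝ≥0) : ℝ≥0∞) with hu
  have hσm : Measurable σ := hw.coe_nnreal_ennreal.pow_const _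
  have hσw : ∀ y, σ y = ((w y ^ (-(1 / (q - 1))) : ℝ≥0) : ℝ≥0∞) := fun y =>
    (ENNReal.coe_rpow_of_ne_zero (hw0 y).ne' _).symm
  have hum : Measurable u :=
    (Measurable.ite (measurableSet_lt measurable_const hg) ((hg.pow_const q).mul hw)
      measurable_const).coe_nnreal_ennreal
  -- Restricting the parameter to powers of 2 leaves countably many null sets, so the parameter may
  -- afterwards depend on x.
  have hsplit : ∀ k : ℤ, ∀ᵐ x ∂μ, (μ⁻[fun y => (g y : ℝ≥0∞)|m]) x ≤
      l + ((2 ^ k : ℝ≥0) : ℝ≥0∞) * (μ⁻[σ|m]) x +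
        (((2 ^ k : ℝ≥0) ^ (1 - q) : ℝ≥0) : ℝ≥0∞) * (μ⁻[u|m]) x := by
    intro k
    set a : ℝ≥0 := 2 ^ k with ha
    have h1 : (fun y => (g y : ℝ≥0∞)) ≤ᵐ[μ]
        ((fun _ => (l : ℝ≥0∞)) + (a : ℝ≥0∞) • σ) + ((a ^ (1 - q) : ℝ≥0) : ℝ≥0∞) • u := by
      refine Eventually.of_forall fun y => ?_
      have := le_add_add_indicator hq (g y) l a (w y) (by positivity) (hw0 y)
      simp only [Pi.add_apply, Pi.smul_apply, smul_eq_mul, hσw, hu]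
      exact_mod_cast this
    filter_upwards [condLExp_mono (mΩ := m) h1,
      condLExp_add_right (mΩ := m) (P := μ) ((fun _ => (l : ℝ≥0∞)) + (a : ℝ≥0∞) • σ)
        (hum.const_smul (((a ^ (1 - q) : ℝ≥0) : ℝ≥0∞))).aemeasurable,
      condLExp_add_right (mΩ := m) (P := μ) (fun _ => (l : ℝ≥0∞))
        (hσm.const_smul (a : ℝ≥0∞)).aemeasurable,
      condLExp_smul' (mΩ := m) (P := μ) σ (c := a) ENNReal.coe_ne_top,
      condLExp_smul' (mΩ := m) (P := μ) u (c := (a ^ (1 - q) : ℝ≥0)) ENNReal.coe_ne_top]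
      with x h2 h3 h4 h5 h6
    rw [h3, Pi.add_apply, h4, Pi.add_apply, h5, h6, condLExp_const hm] at h2
    exact h2
  have hw' : ∀ x, (w x : ℝ≥0∞) ≠ 0 := fun x => by simpa using (hw0 x).ne'
  have hσ0 : ∀ x, σ x ≠ 0 := fun x => by
    rw [hσw]
    have := hw0 x
    simp only [ne_eq, ENNReal.coe_eq_zero]
    positivity
  filter_upwards [hA, ae_all_iff.2 hsplit, condLExp_ae_ne_zero hm μ hσm hσ0,
    condLExp_ae_ne_zero hm μ hw.coe_nnreal_ennreal hw'] with x hA hs hS hW hx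
  exact rpow_mul_le_of_forall_zpow hq hl hS hW hA fun k => hx.le.trans (hs k)

/-- Stopping-time argument: the `n`-th disjointed set is where n is the first time the level 2l is
exceeded. It lies in `ℱ n`, so the conditional estimate integrates over it. Keeping the truncation g
> l is what makes the later sum over levels converge. -/
theorem lintegral_le_of_weak_type {Ω : Type*} {m0 : MeasurableSpace Ω} {μ : Measure Ω}
    [IsProbabilityMeasure μ] (ℱ : Filtration ℕ m0) {q : ℝ} (hq : 1 < q) {K l : ℝ≥0} (hl : 0 < l)
    {w g : Ω → ℝ≥0} (hw : Measurable w) (hw0 : ∀ x, 0 < w x) (hg : Measurable g)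
    (hA : ∀ n, ∀ᵐ x ∂μ, (μ⁻[fun y => (w y : ℝ≥0∞)|ℱ n]) x *
      ((μ⁻[fun y => (w y : ℝ≥0∞) ^ (-(1 / (q - 1)))|ℱ n]) x) ^ (q - 1) ≤ K) :
    ((l ^ q : ℝ≥0) : ℝ≥0∞) *
      ∫⁻ x in {x | 2 * (l : ℝ≥0∞) < ⨆ n, (μ⁻[fun y => (g y : ℝ≥0∞)|ℱ n]) x}, w x ∂μ ≤
      ((2 * 4 ^ (q - 1) * K : ℝ≥0) : ℝ≥0∞) *
        ∫⁻ x, ((if l < g x then g x ^ q * w x else 0 : ℝ≥0) : ℝ≥0∞) ∂μ := by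
  set A : ℕ → Set Ω := fun n => {x | 2 * (l : ℝ≥0∞) < (μ⁻[fun y => (g y : ℝ≥0∞)|ℱ n]) x} with hAdef
  have hAm : ∀ n, MeasurableSet[ℱ n] (A n) := fun n =>
    measurable_condLExp (ℱ n) μ _ measurableSet_Ioi
  have hDm : ∀ n, MeasurableSet[ℱ n] (disjointed A n) := by
    intro n
    rw [disjointed_apply]
    refine (hAm n).diff ?_
    rw [Finset.sup_set_eq_biUnion]
    exact Finset.measurableSet_biUnion _ fun i hi =>
      ℱ.mono (Finset.mem_Iio.1 hi).le _ (hAm i)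
  have hU : {x | 2 * (l : ℝ≥0∞) < ⨆ n, (μ⁻[fun y => (g y : ℝ≥0∞)|ℱ n]) x} =
      ⋃ n, disjointed A n := by
    rw [iUnion_disjointed]
    ext x
    simp [hAdef, lt_iSup_iff]
  set u : Ω → ℝ≥0∞ := fun y => ((if l < g y then g y ^ q * w y else 0 : ℝ≥0) : ℝ≥0∞) with hu
  have hD0 := fun n => ℱ.le n _ (hDm n)
  have hstep : ∀ n, ((l ^ q : ℝ≥0) : ℝ≥0∞) * ∫⁻ x in disjointed A n, w x ∂μ ≤
      ((2 * 4 ^ (q - 1) * K : ℝ≥0) : ℝ≥0∞) * ∫⁻ x in disjointed A n, u x ∂μ := by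
    intro n
    rw [← setLIntegral_condLExp (ℱ.le n) μ u (hDm n),
      ← setLIntegral_condLExp (ℱ.le n) μ (fun x => (w x : ℝ≥0∞)) (hDm n),
      ← lintegral_const_mul' _ _ ENNReal.coe_ne_top, ← lintegral_const_mul' _ _ ENNReal.coe_ne_top]
    refine setLIntegral_mono_ae' (hD0 n) ?_
    filter_upwards [ae_rpow_mul_condLExp_le (ℱ.le n) hq hl hw hw0 hg (hA n)] with x hx hxD
    exact hx (disjointed_subset A n hxD)
  rw [hU, lintegral_iUnion hD0 (disjoint_disjointed A), ← ENNReal.tsum_mul_left]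
  calc _ ≤ ∑' n, ((2 * 4 ^ (q - 1) * K : ℝ≥0) : ℝ≥0∞) * ∫⁻ x in disjointed A n, u x ∂μ :=
        ENNReal.tsum_le_tsum hstep
    _ = ((2 * 4 ^ (q - 1) * K : ℝ≥0) : ℝ≥0∞) * ∫⁻ x in ⋃ n, disjointed A n, u x ∂μ := by
      rw [lintegral_iUnion hD0 (disjoint_disjointed A), ENNReal.tsum_mul_left]
    _ ≤ _ := by gcongr; exact Measure.restrict_le_self

/-! ### Summation over dyadic levels -/

theorem tsum_zpow_div_rpow_le {δ : ℝ} (hδ : 0 < δ) {g : ℝ≥0} (hg : 0 < g) :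
    ∑' k : ℤ, (if (2 : ℝ≥0) ^ k < g then (((2 ^ k / g) ^ δ : ℝ≥0) : ℝ≥0∞) else 0) ≤
      (1 - (((2⁻¹ : ℝ≥0) ^ δ : ℝ≥0) : ℝ≥0∞))⁻¹ := by
  -- With 2^j < g ≤ 2^{j+1} only k = j - n, n ≥ 0, contribute, and then 2^k/g ≤ 2^{-n}.
  obtain ⟨j, hj1, hj2⟩ := NNReal.exists_mem_Ioc_zpow (x := g) (y := 2) hg.ne' (by norm_num)
  have hinj : Function.Injective fun n : ℕ => j - (n : ℤ) := fun a b h => by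
    simpa using h
  rw [← hinj.tsum_eq, ← ENNReal.tsum_geometric]
  · refine ENNReal.tsum_le_tsum fun n => ?_
    split_ifs
    · have h1 : (2 : ℝ≥0) ^ (j - (n : ℤ)) / g ≤ 2⁻¹ ^ n := by
        rw [div_le_iff₀ hg, zpow_sub₀ two_ne_zero, zpow_natCast, div_eq_inv_mul, inv_pow]
        gcongr
      calc _ ≤ ((((2⁻¹ : ℝ≥0) ^ n) ^ δ : ℝ≥0) : ℝ≥0∞) := by gcongr
        _ = _ := by
          rw [← ENNReal.coe_pow, ← NNReal.rpow_natCast, ← NNReal.rpow_mul, mul_comm,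
            NNReal.rpow_mul, NNReal.rpow_natCast]
    · exact zero_le
  · intro k hk
    have hlt : (2 : ℝ≥0) ^ k < g := by
      by_contra h
      simp [h] at hk
    have hkj : k ≤ j := by
      have := (zpow_lt_zpow_iff_right₀ (one_lt_two : (1 : ℝ≥0) < 2)).1 (hlt.trans_le hj2)
      omega
    exact ⟨(j - k).toNat, by simp; omega⟩

/-- The lower type with s = 2^k/g gains (2^k/g)^p against the loss (g/2^k)^q. -/
theorem tsum_levels_le {ψ : ℝ≥0 → ℝ≥0} {p q : ℝ} (hqp : q < p) {c : ℝ≥0}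
    (hlow : ∀ t s : ℝ≥0, 0 < s → s < 1 → ψ (s * t) ≤ c * s ^ p * ψ t) (g : ℝ≥0) :
    ∑' k : ℤ, ((((2 ^ k : ℝ≥0) ^ q)⁻¹ : ℝ≥0) : ℝ≥0∞) *
        ((if (2 : ℝ≥0) ^ k < g then g ^ q * ψ (2 ^ k) else 0 : ℝ≥0) : ℝ≥0∞) ≤
      c * (1 - (((2⁻¹ : ℝ≥0) ^ (p - q) : ℝ≥0) : ℝ≥0∞))⁻¹ * ψ g := by
  rcases eq_or_ne g 0 with rfl | hg
  · simp
  have hg : 0 < g := pos_iff_ne_zero.2 hg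
  calc _ ≤ ∑' k : ℤ, (c * ψ g : ℝ≥0∞) *
        (if (2 : ℝ≥0) ^ k < g then (((2 ^ k / g) ^ (p - q) : ℝ≥0) : ℝ≥0∞) else 0) := by
        refine ENNReal.tsum_le_tsum fun k => ?_
        set a : ℝ≥0 := 2 ^ k with ha
        have ha0 : 0 < a := by positivity
        split_ifs with hk
        · have h := hlow g (a / g) (by positivity) ((div_lt_one hg).2 hk)
          rw [div_mul_cancel₀ _ hg.ne'] at h
          norm_cast
          have h0 : a / g ≠ 0 := (div_pos ha0 hg).ne'
          calc (a ^ q)⁻¹ * (g ^ q * ψ a) ≤ (a ^ q)⁻¹ * (g ^ q * (c * (a / g) ^ p * ψ g)) := by gcongr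
            _ = c * ψ g * ((a / g) ^ p * ((a / g) ^ q)⁻¹) := by
              rw [NNReal.div_rpow a g q, inv_div]; ring
            _ = _ := by rw [NNReal.rpow_sub h0, div_eq_mul_inv ((a / g) ^ p)]
        · simp
    _ ≤ c * ψ g * (1 - (((2⁻¹ : ℝ≥0) ^ (p - q) : ℝ≥0) : ℝ≥0∞))⁻¹ := by
        rw [ENNReal.tsum_mul_left]
        gcongr
        exact tsum_zpow_div_rpow_le (sub_pos.2 hqp) hg
    _ = _ := by ring

/-! ### Dyadic form of the modular estimate -/

/-- The maximal function of a nonnegative function. -/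
noncomputable def lmax {Ω : Type*} {m0 : MeasurableSpace Ω} (μ : Measure Ω)
    (ℱ : Filtration ℕ m0) (g : Ω → ℝ≥0) (x : Ω) : ℝ≥0∞ :=
  ⨆ n, (μ⁻[fun y => (g y : ℝ≥0∞)|ℱ n]) x

theorem measurable_lmax {Ω : Type*} {m0 : MeasurableSpace Ω} (μ : Measure Ω)
    (ℱ : Filtration ℕ m0) (g : Ω → ℝ≥0) : Measurable (lmax μ ℱ g) :=
  Measurable.iSup fun _ => measurable_condLExp' _ _ _

/-- A dyadic substitute for `φ(x, G)`, measurable in `x` and meaningful for `G = ∞`. -/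
noncomputable def dyadicSum {Ω : Type*} (φ : Ω → ℝ≥0 → ℝ≥0) (G : Ω → ℝ≥0∞) (x : Ω) : ℝ≥0∞ :=
  ∑' k : ℤ, {x | 2 * ((2 ^ k : ℝ≥0) : ℝ≥0∞) < G x}.indicator
    (fun x => (φ x (2 ^ k) : ℝ≥0∞)) x

theorem IsMusielakOrlicz.measurable_dyadicSum {Ω : Type*} [MeasurableSpace Ω]
    {φ : Ω → ℝ≥0 → ℝ≥0} (hφ : IsMusielakOrlicz φ) {G : Ω → ℝ≥0∞} (hG : Measurable G) :
    Measurable (dyadicSum φ G) :=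
  Measurable.tsum fun _ => (hφ.measurable _).coe_nnreal_ennreal.indicator
    (measurableSet_lt measurable_const hG)

theorem IsMusielakOrlicz.dyadicSum_eq_top {Ω : Type*} [MeasurableSpace Ω]
    {φ : Ω → ℝ≥0 → ℝ≥0} (hφ : IsMusielakOrlicz φ) {G : Ω → ℝ≥0∞} {x : Ω} (hx : G x = ∞) :
    dyadicSum φ G x = ∞ := by
  refine ENNReal.eq_top_of_forall_nnreal_le fun r => ?_
  have h2 : Tendsto (fun n : ℕ => (2 : ℝ≥0) ^ n) atTop atTop :=
    tendsto_pow_atTop_atTop_of_one_lt one_lt_two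
  obtain ⟨n, hn⟩ := (((hφ.tendsto x).comp h2).eventually_ge_atTop r).exists
  refine le_trans ?_ (ENNReal.le_tsum (n : ℤ))
  rw [Set.indicator_of_mem]
  · simpa using hn
  · simp [hx, ENNReal.mul_lt_top_iff]

theorem IsMusielakOrlicz.le_dyadicSum {Ω : Type*} [MeasurableSpace Ω] {φ : Ω → ℝ≥0 → ℝ≥0}
    (hφ : IsMusielakOrlicz φ) {p : ℝ} {c : ℝ≥0}
    (hupp : ∀ (x : Ω) (t s : ℝ≥0), 1 ≤ s → φ x (s * t) ≤ c * s ^ p * φ x t)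
    {G : Ω → ℝ≥0∞} {x : Ω} {h : ℝ≥0} (hh : (h : ℝ≥0∞) ≤ G x) :
    (φ x h : ℝ≥0∞) ≤ ((c * 4 ^ p : ℝ≥0) : ℝ≥0∞) * dyadicSum φ G x := by
  rcases eq_or_ne h 0 with rfl | h0
  · simp [hφ.zero x]
  -- The single term k = j - 1 suffices: 2·2^k < h ≤ 4·2^k, whence the factor 4^p.
  obtain ⟨j, hj1, hj2⟩ := NNReal.exists_mem_Ioc_zpow (x := h) (y := 2) h0 (by norm_num)
  have e1 : (2 : ℝ≥0) ^ j = 2 * 2 ^ (j - 1) := by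
    rw [← zpow_one_add₀ two_ne_zero]; ring_nf
  have e2 : (2 : ℝ≥0) ^ (j + 1) = 4 * 2 ^ (j - 1) := by
    rw [zpow_add₀ two_ne_zero, e1, zpow_one]; ring
  rw [e1] at hj1
  have h1 : φ x h ≤ c * 4 ^ p * φ x (2 ^ (j - 1)) :=
    (hφ.mono x (hj2.trans_eq e2)).trans (hupp x _ 4 (by norm_num))
  calc (φ x h : ℝ≥0∞) ≤ ((c * 4 ^ p : ℝ≥0) : ℝ≥0∞) * (φ x (2 ^ (j - 1)) : ℝ≥0∞) := by
        exact_mod_cast h1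
    _ ≤ _ := by
        gcongr
        refine le_trans ?_ (ENNReal.le_tsum (j - 1))
        rw [Set.indicator_of_mem]
        refine lt_of_lt_of_le ?_ hh
        exact_mod_cast hj1

/-- The weak-type bound is applied at each level 2^k with its own weight φ(·, 2^k), then summed by
Tonelli. -/
theorem lintegral_dyadicSum_lmax_le {Ω : Type*} {m0 : MeasurableSpace Ω} {μ : Measure Ω}
    [IsProbabilityMeasure μ] {ℱ : Filtration ℕ m0} {φ : Ω → ℝ≥0 → ℝ≥0}
    (hφ : IsMusielakOrlicz φ) {p q : ℝ} (hq : 1 < q) (hqp : q < p) (hA : IsAq μ ℱ φ q)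
    {c : ℝ≥0} (hlow : ∀ (x : Ω) (t s : ℝ≥0), 0 < s → s < 1 →
      φ x (s * t) ≤ c * s ^ p * φ x t) :
    ∃ C : ℝ≥0, ∀ g : Ω → ℝ≥0, Measurable g →
      ∫⁻ x, dyadicSum φ (lmax μ ℱ g) x ∂μ ≤ C * ∫⁻ x, φ x (g x) ∂μ := by
  obtain ⟨-, hpos, K, -, hK, -⟩ := hA
  have hr : (1 - (((2⁻¹ : ℝ≥0) ^ (p - q) : ℝ≥0) : ℝ≥0∞))⁻¹ ≠ ∞ := by
    rw [ENNReal.inv_ne_top]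
    refine (tsub_pos_of_lt ?_).ne'
    exact_mod_cast NNReal.rpow_lt_one (by norm_num) (sub_pos.2 hqp)
  lift (1 - (((2⁻¹ : ℝ≥0) ^ (p - q) : ℝ≥0) : ℝ≥0∞))⁻¹ to ℝ≥0 using hr with R hR
  refine ⟨2 * 4 ^ (q - 1) * K * (c * R), fun g hg => ?_⟩
  have hGm := measurable_lmax μ ℱ g
  have hset : ∀ k : ℤ, MeasurableSet {x | 2 * ((2 ^ k : ℝ≥0) : ℝ≥0∞) < lmax μ ℱ g x} := fun k =>
    measurableSet_lt measurable_const hGm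
  set u : ℤ → Ω → ℝ≥0∞ := fun k x => ((((2 ^ k : ℝ≥0) ^ q)⁻¹ : ℝ≥0) : ℝ≥0∞) *
        ((if (2 : ℝ≥0) ^ k < g x then g x ^ q * φ x (2 ^ k) else 0 : ℝ≥0) : ℝ≥0∞) with hu
  have hum : ∀ k, Measurable (u k) := fun k =>
    (Measurable.ite (measurableSet_lt measurable_const hg)
      ((hg.pow_const q).mul (hφ.measurable _)) measurable_const).coe_nnreal_ennreal.const_mul _
  have hk : ∀ k : ℤ, ∫⁻ x, {x | 2 * ((2 ^ k : ℝ≥0) : ℝ≥0∞) < lmax μ ℱ g x}.indicator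
      (fun x => (φ x (2 ^ k) : ℝ≥0∞)) x ∂μ ≤
      ((2 * 4 ^ (q - 1) * K : ℝ≥0) : ℝ≥0∞) * ∫⁻ x, u k x ∂μ := by
    intro k
    rw [lintegral_indicator (hset k), hu, lintegral_const_mul' _ _ ENNReal.coe_ne_top]
    set a : ℝ≥0 := 2 ^ k with ha
    have ha0 : 0 < a := by positivity
    have haq : a ^ q ≠ 0 := by positivity
    have h := lintegral_le_of_weak_type ℱ hq (l := a) ha0 (hφ.measurable a)
      (fun x => hpos x a ha0) hg (fun n => hK hq n a ha0)
    rw [mul_left_comm, ENNReal.coe_inv haq,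
      ← ENNReal.mul_le_iff_le_inv (by simpa using haq) ENNReal.coe_ne_top]
    exact h
  calc ∫⁻ x, dyadicSum φ (lmax μ ℱ g) x ∂μ
      = ∑' k : ℤ, ∫⁻ x, {x | 2 * ((2 ^ k : ℝ≥0) : ℝ≥0∞) < lmax μ ℱ g x}.indicator
          (fun x => (φ x (2 ^ k) : ℝ≥0∞)) x ∂μ := lintegral_tsum fun k =>
            ((hφ.measurable _).coe_nnreal_ennreal.indicator (hset k)).aemeasurable
    _ ≤ ∑' k : ℤ, ((2 * 4 ^ (q - 1) * K : ℝ≥0) : ℝ≥0∞) * ∫⁻ x, u k x ∂μ :=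
        ENNReal.tsum_le_tsum hk
    _ = ((2 * 4 ^ (q - 1) * K : ℝ≥0) : ℝ≥0∞) * ∫⁻ x, ∑' k : ℤ, u k x ∂μ := by
        rw [ENNReal.tsum_mul_left, lintegral_tsum fun k => (hum k).aemeasurable]
    _ ≤ ((2 * 4 ^ (q - 1) * K : ℝ≥0) : ℝ≥0∞) *
          ∫⁻ x, ((c * R : ℝ≥0) : ℝ≥0∞) * (φ x (g x) : ℝ≥0∞) ∂μ := by
        gcongr with x
        have := tsum_levels_le hqp (hlow x) (g x)
        rw [← hR] at this
        exact_mod_cast this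
    _ = _ := by
        rw [lintegral_const_mul' _ _ ENNReal.coe_ne_top, ← mul_assoc, ← ENNReal.coe_mul]

/-- If the index found below p is 1, A_1 ⊆ A_r supplies an exponent r strictly between 1 and p. -/
theorem exists_isAq {Ω : Type*} {m0 : MeasurableSpace Ω} {μ : Measure Ω}
    [IsProbabilityMeasure μ] {ℱ : Filtration ℕ m0} {φ : Ω → ℝ≥0 → ℝ≥0}
    (hA : IsAinfty μ ℱ φ) {p : ℝ} (hp : criticalIndex μ ℱ φ < p) :
    ∃ q, 1 < q ∧ q < p ∧ IsAq μ ℱ φ q := by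
  obtain ⟨q, hq, hqp⟩ := exists_lt_of_csInf_lt (s := {q : ℝ | IsAq μ ℱ φ q}) hA hp
  have hq : IsAq μ ℱ φ q := hq
  rcases hq.1.eq_or_lt with rfl | h1
  · obtain ⟨r, hr1, hr2⟩ := exists_between hqp
    exact ⟨r, hr1, hr2, hq.of_one hr1⟩
  · exact ⟨q, h1, hqp, hq⟩

/-! ### Signed functions: modular inequality and finiteness -/

theorem measurable_genCondExp {Ω : Type*} (m : MeasurableSpace Ω) {m0 : MeasurableSpace Ω}
    (μ : Measure Ω) (f : Ω → ℝ) : Measurable (genCondExp μ m f) :=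
  Measurable.sub (f := fun x => ((μ⁻[fun y => ENNReal.ofReal (f y)|m]) x).toReal)
    (g := fun x => ((μ⁻[fun y => ENNReal.ofReal (-f y)|m]) x).toReal)
    (measurable_condLExp' _ _ _).ennreal_toReal (measurable_condLExp' _ _ _).ennreal_toReal

theorem measurable_doobMax {Ω : Type*} {m0 : MeasurableSpace Ω} (μ : Measure Ω)
    (ℱ : Filtration ℕ m0) (f : Ω → ℝ) : Measurable (doobMax μ ℱ f) :=
  Measurable.iSup fun n => (measurable_genCondExp (ℱ n) μ f).enorm

theorem enorm_toReal_sub_toReal_le {a b c : ℝ≥0∞} (ha : a ≤ c) (hb : b ≤ c) :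
    ‖a.toReal - b.toReal‖ₑ ≤ c := by
  rcases eq_or_ne c ∞ with rfl | hc
  · exact le_top
  rw [Real.enorm_eq_ofReal_abs]
  refine ENNReal.ofReal_le_of_le_toReal (abs_sub_le_of_nonneg_of_le ?_ ?_ ?_ ?_)
  · exact ENNReal.toReal_nonneg
  · exact ENNReal.toReal_mono hc ha
  · exact ENNReal.toReal_nonneg
  · exact ENNReal.toReal_mono hc hb

theorem enorm_genCondExp_le {Ω : Type*} {m0 : MeasurableSpace Ω} (μ : Measure Ω)
    (m : MeasurableSpace Ω) (f : Ω → ℝ) :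
    ∀ᵐ x ∂μ, ‖genCondExp μ m f x‖ₑ ≤ (μ⁻[fun y => ‖f y‖ₑ|m]) x := by
  have h1 : (fun y => ENNReal.ofReal (f y)) ≤ᵐ[μ] fun y => ‖f y‖ₑ :=
    Eventually.of_forall fun y => Real.ofReal_le_enorm _
  have h2 : (fun y => ENNReal.ofReal (-f y)) ≤ᵐ[μ] fun y => ‖f y‖ₑ :=
    Eventually.of_forall fun y => (Real.ofReal_le_enorm _).trans_eq (enorm_neg _)
  filter_upwards [condLExp_mono (mΩ := m) h1, condLExp_mono (mΩ := m) h2] with x h1 h2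
  exact enorm_toReal_sub_toReal_le h1 h2

theorem doobMax_le_lmax {Ω : Type*} {m0 : MeasurableSpace Ω} (μ : Measure Ω)
    (ℱ : Filtration ℕ m0) (f : Ω → ℝ) :
    ∀ᵐ x ∂μ, doobMax μ ℱ f x ≤ lmax μ ℱ (fun y => ‖f y‖₊) x := by
  filter_upwards [ae_all_iff.2 fun n => enorm_genCondExp_le μ (ℱ n) f] with x hx
  exact iSup_mono hx

theorem nnnorm_toReal_le (a : ℝ≥0∞) : ((‖a.toReal‖₊ : ℝ≥0) : ℝ≥0∞) ≤ a := by
  rw [← enorm_eq_nnnorm, Real.enorm_of_nonneg ENNReal.toReal_nonneg]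
  exact ENNReal.ofReal_toReal_le

/-- No finiteness of M(f) is needed: `toReal` sends ∞ to 0, so it can only decrease the left side.
-/
theorem modular_doobMax_le {Ω : Type*} {m0 : MeasurableSpace Ω} {μ : Measure Ω}
    [IsProbabilityMeasure μ] {ℱ : Filtration ℕ m0} {φ : Ω → ℝ≥0 → ℝ≥0}
    (hφ : IsMusielakOrlicz φ) {p : ℝ} {c C : ℝ≥0}
    (hupp : ∀ (x : Ω) (t s : ℝ≥0), 1 ≤ s → φ x (s * t) ≤ c * s ^ p * φ x t)
    (hC : ∀ g : Ω → ℝ≥0, Measurable g →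
      ∫⁻ x, dyadicSum φ (lmax μ ℱ g) x ∂μ ≤ C * ∫⁻ x, φ x (g x) ∂μ)
    {f : Ω → ℝ} (hf : Measurable f) :
    modular μ φ (fun x => (doobMax μ ℱ f x).toReal) ≤
      ((c * 4 ^ p * C : ℝ≥0) : ℝ≥0∞) * modular μ φ f := by
  calc modular μ φ (fun x => (doobMax μ ℱ f x).toReal)
      ≤ ∫⁻ x, ((c * 4 ^ p : ℝ≥0) : ℝ≥0∞) * dyadicSum φ (lmax μ ℱ fun y => ‖f y‖₊) x ∂μ := by
        refine lintegral_mono_ae ?_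
        filter_upwards [doobMax_le_lmax μ ℱ f] with x hx
        exact hφ.le_dyadicSum hupp ((nnnorm_toReal_le _).trans hx)
    _ ≤ ((c * 4 ^ p : ℝ≥0) : ℝ≥0∞) * (C * modular μ φ f) := by
        rw [lintegral_const_mul' _ _ ENNReal.coe_ne_top]
        gcongr
        exact hC _ hf.nnnorm
    _ = _ := by rw [ENNReal.coe_mul _ C, mul_assoc]

theorem lmax_ae_lt_top {Ω : Type*} {m0 : MeasurableSpace Ω} {μ : Measure Ω}
    {ℱ : Filtration ℕ m0} {φ : Ω → ℝ≥0 → ℝ≥0} (hφ : IsMusielakOrlicz φ) {C : ℝ≥0}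
    (hC : ∀ g : Ω → ℝ≥0, Measurable g →
      ∫⁻ x, dyadicSum φ (lmax μ ℱ g) x ∂μ ≤ C * ∫⁻ x, φ x (g x) ∂μ)
    {g : Ω → ℝ≥0} (hg : Measurable g) (hfin : ∫⁻ x, φ x (g x) ∂μ ≠ ∞) :
    ∀ᵐ x ∂μ, lmax μ ℱ g x < ∞ := by
  have h := (hC g hg).trans_lt (ENNReal.mul_lt_top ENNReal.coe_lt_top hfin.lt_top)
  filter_upwards [ae_lt_top (hφ.measurable_dyadicSum (measurable_lmax μ ℱ g)) h.ne] with x hx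
  rw [lt_top_iff_ne_top]
  exact fun hx' => hx.ne (hφ.dyadicSum_eq_top hx')

/-! ### Homogeneity and the Luxemburg norm -/

theorem condLExp_const_mul {Ω : Type*} {m m0 : MeasurableSpace Ω} (μ : Measure Ω)
    (f : Ω → ℝ≥0∞) (c : ℝ≥0) :
    ∀ᵐ x ∂μ, (μ⁻[fun y => (c : ℝ≥0∞) * f y|m]) x = c * (μ⁻[f|m]) x :=
  condLExp_smul' (mΩ := m) f ENNReal.coe_ne_top

theorem genCondExp_const_mul {Ω : Type*} {m0 : MeasurableSpace Ω} (μ : Measure Ω)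
    (m : MeasurableSpace Ω) (f : Ω → ℝ) (c : ℝ≥0) :
    ∀ᵐ x ∂μ, genCondExp μ m (fun y => c * f y) x = c * genCondExp μ m f x := by
  have e1 : (fun y => ENNReal.ofReal (c * f y)) = fun y => (c : ℝ≥0∞) * ENNReal.ofReal (f y) := by
    ext y
    rw [ENNReal.ofReal_mul c.coe_nonneg, ENNReal.ofReal_coe_nnreal]
  have e2 : (fun y => ENNReal.ofReal (-(c * f y))) =
      fun y => (c : ℝ≥0∞) * ENNReal.ofReal (-f y) := by
    ext y
    rw [← mul_neg, ENNReal.ofReal_mul c.coe_nonneg, ENNReal.ofReal_coe_nnreal]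
  filter_upwards [condLExp_const_mul (m := m) μ (fun y => ENNReal.ofReal (f y)) c,
    condLExp_const_mul (m := m) μ (fun y => ENNReal.ofReal (-f y)) c] with x h1 h2
  simp only [genCondExp, e1, e2, h1, h2, ENNReal.toReal_mul, ENNReal.coe_toReal, mul_sub]

theorem doobMax_const_mul {Ω : Type*} {m0 : MeasurableSpace Ω} (μ : Measure Ω)
    (ℱ : Filtration ℕ m0) (f : Ω → ℝ) (c : ℝ≥0) :
    ∀ᵐ x ∂μ, doobMax μ ℱ (fun y => c * f y) x = c * doobMax μ ℱ f x := by
  filter_upwards [ae_all_iff.2 fun n => genCondExp_const_mul μ (ℱ n) f c] with x hx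
  simp only [doobMax, hx, enorm_mul, ENNReal.mul_iSup]
  simp [enorm_eq_nnnorm]

/-- The lower type absorbs the modular constant: choose s with c s^p C ≤ 1. If a is admissible for
f, then a/s is admissible for M(f), so D = 1/s works. -/
theorem luxNorm_doobMax_le {Ω : Type*} {m0 : MeasurableSpace Ω} {μ : Measure Ω}
    {ℱ : Filtration ℕ m0} {φ : Ω → ℝ≥0 → ℝ≥0} {p : ℝ} {c : ℝ≥0} (hp : 0 < p)
    (hlow : ∀ (x : Ω) (t s : ℝ≥0), 0 < s → s < 1 → φ x (s * t) ≤ c * s ^ p * φ x t)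
    {C : ℝ≥0} (hC : ∀ f : Ω → ℝ, Measurable f →
      modular μ φ (fun x => (doobMax μ ℱ f x).toReal) ≤ C * modular μ φ f) :
    ∃ D : ℝ≥0, 0 < D ∧ ∀ f : Ω → ℝ, Measurable f →
      luxNorm μ φ (fun x => (doobMax μ ℱ f x).toReal) ≤ D * luxNorm μ φ f := by
  obtain ⟨s, hs0, hs1, hs⟩ : ∃ s : ℝ≥0, 0 < s ∧ s < 1 ∧ c * s ^ p * C ≤ 1 := by
    have h : Tendsto (fun s : ℝ≥0 => c * s ^ p * C) (nhdsWithin 0 (Set.Ioi 0)) (nhds 0) := by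
      have : ContinuousAt (fun s : ℝ≥0 => c * s ^ p * C) 0 :=
        ((NNReal.continuousAt_rpow_const (Or.inr hp.le)).const_mul c).mul_const C
      have := this.tendsto
      simp only [NNReal.zero_rpow hp.ne', mul_zero, zero_mul] at this
      exact this.mono_left nhdsWithin_le_nhds
    have h1 : ∀ᶠ s : ℝ≥0 in nhdsWithin 0 (Set.Ioi 0), s < 1 :=
      nhdsWithin_le_nhds (Iio_mem_nhds one_pos)
    obtain ⟨s, h1, h2, h3⟩ :=
      (h1.and ((h.eventually_le_const one_pos).and self_mem_nhdsWithin)).exists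
    exact ⟨s, h3, h1, h2⟩
  refine ⟨s⁻¹, by positivity, fun f hf => ?_⟩
  rw [ENNReal.coe_inv hs0.ne', ← ENNReal.mul_le_iff_le_inv (by simpa using hs0.ne') ENNReal.coe_ne_top]
  refine le_iInf₂ fun a ⟨ha, hfa⟩ => ?_
  have hmain : luxNorm μ φ (fun x => (doobMax μ ℱ f x).toReal) ≤ ((a / s : ℝ≥0) : ℝ≥0∞) := by
    refine iInf₂_le (a / s) ⟨by positivity, ?_⟩
    have e : (fun x => f x / a) = fun x => ((a⁻¹ : ℝ≥0) : ℝ) * f x := by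
      ext x; rw [NNReal.coe_inv, div_eq_inv_mul]
    rw [e] at hfa
    calc modular μ φ (fun x => (doobMax μ ℱ f x).toReal / ((a / s : ℝ≥0) : ℝ))
        ≤ ∫⁻ x, ((c * s ^ p : ℝ≥0) : ℝ≥0∞) *
            (φ x ‖(doobMax μ ℱ (fun y => ((a⁻¹ : ℝ≥0) : ℝ) * f y) x).toReal‖₊ : ℝ≥0∞) ∂μ := by
          refine lintegral_mono_ae ?_
          filter_upwards [doobMax_const_mul μ ℱ f a⁻¹] with x hx
          have hx' : ‖(doobMax μ ℱ f x).toReal / ((a / s : ℝ≥0) : ℝ)‖₊ =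
              s * ‖(doobMax μ ℱ (fun y => ((a⁻¹ : ℝ≥0) : ℝ) * f y) x).toReal‖₊ := by
            rw [hx, ENNReal.toReal_mul, nnnorm_div, nnnorm_mul]
            simp only [ENNReal.coe_toReal, NNReal.nnnorm_eq]
            field_simp
          rw [hx']
          exact_mod_cast hlow x _ s hs0 hs1
      _ ≤ ((c * s ^ p : ℝ≥0) : ℝ≥0∞) * (C * 1) := by
          rw [lintegral_const_mul' _ _ ENNReal.coe_ne_top]
          gcongr
          exact (hC _ (hf.const_mul _)).trans (by gcongr)
      _ ≤ 1 := by
          rw [mul_one]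
          exact_mod_cast hs
  calc (s : ℝ≥0∞) * _ ≤ s * ((a / s : ℝ≥0) : ℝ≥0∞) := by gcongr
    _ = a := by
      rw [← ENNReal.coe_mul, mul_div_cancel₀ _ hs0.ne']

/-- Some f/a has modular at most 1, so its maximal function is finite; homogeneity transfers this to
f. -/
theorem MemLphi.lmax_ae_lt_top {Ω : Type*} {m0 : MeasurableSpace Ω} {μ : Measure Ω}
    {ℱ : Filtration ℕ m0} {φ : Ω → ℝ≥0 → ℝ≥0} (hφ : IsMusielakOrlicz φ) {C : ℝ≥0}
    (hC : ∀ g : Ω → ℝ≥0, Measurable g →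
      ∫⁻ x, dyadicSum φ (lmax μ ℱ g) x ∂μ ≤ C * ∫⁻ x, φ x (g x) ∂μ)
    {f : Ω → ℝ} (hf : MemLphi μ φ f) : ∀ᵐ x ∂μ, lmax μ ℱ (fun y => ‖f y‖₊) x < ∞ := by
  obtain ⟨hfm, hfin⟩ := hf
  simp only [luxNorm, iInf_lt_iff] at hfin
  obtain ⟨a, ⟨ha, hfa⟩, -⟩ := hfin
  have h1 := MusielakOrlicz.lmax_ae_lt_top hφ hC (hfm.div_const (a : ℝ)).nnnorm
    (ne_top_of_le_ne_top ENNReal.one_ne_top hfa)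
  have e : (fun y => ((‖f y‖₊ : ℝ≥0) : ℝ≥0∞)) =
      fun y => (a : ℝ≥0∞) * ((‖f y / (a : ℝ)‖₊ : ℝ≥0) : ℝ≥0∞) := by
    ext y
    rw [← ENNReal.coe_mul, nnnorm_div, NNReal.nnnorm_eq, mul_div_cancel₀ _ ha.ne']
  filter_upwards [h1, ae_all_iff.2 fun n => condLExp_const_mul (m := ℱ n) μ
    (fun y => ((‖f y / (a : ℝ)‖₊ : ℝ≥0) : ℝ≥0∞)) a] with x hx hn
  simp only [lmax, e, hn, ← ENNReal.mul_iSup]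
  exact ENNReal.mul_lt_top ENNReal.coe_lt_top hx

end MusielakOrlicz

theorem mainTheorem3 {Ω : Type*} {m0 : MeasurableSpace Ω} (μ : Measure Ω)
    [IsProbabilityMeasure μ] (ℱ : Filtration ℕ m0) (φ : Ω → ℝ≥0 → ℝ≥0)
    (hφ : MusielakOrlicz.IsMusielakOrlicz φ)
    (hA : MusielakOrlicz.IsAinfty μ ℱ φ)
    (pminus pplus : ℝ)
    (hlow : MusielakOrlicz.HasLowerType φ pminus)
    (hupp : MusielakOrlicz.HasUpperType φ pplus)
    (hq : MusielakOrlicz.criticalIndex μ ℱ φ < pminus) (hp : pminus ≤ pplus) :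
    -- `M(f)` is well defined and finite almost everywhere for every `f ∈ L^φ`
    (∀ f : Ω → ℝ, MusielakOrlicz.MemLphi μ φ f →
      (∀ n : ℕ, ∀ᵐ x ∂μ, (μ⁻[fun y => ‖f y‖ₑ|ℱ n]) x < ∞) ∧
      (∀ᵐ x ∂μ, MusielakOrlicz.doobMax μ ℱ f x < ∞)) ∧
    -- `M` is bounded on `L^φ`
    (∃ C : ℝ≥0, 0 < C ∧ ∀ f : Ω → ℝ, MusielakOrlicz.MemLphi μ φ f →
      MusielakOrlicz.MemLphi μ φ (fun x => (MusielakOrlicz.doobMax μ ℱ f x).toReal) ∧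
      MusielakOrlicz.luxNorm μ φ (fun x => (MusielakOrlicz.doobMax μ ℱ f x).toReal) ≤
        C * MusielakOrlicz.luxNorm μ φ f) ∧
    -- the modular inequality
    (∃ C : ℝ≥0, 0 < C ∧ ∀ f : Ω → ℝ, MusielakOrlicz.MemLphi μ φ f →
      MusielakOrlicz.modular μ φ (fun x => (MusielakOrlicz.doobMax μ ℱ f x).toReal) ≤
        C * MusielakOrlicz.modular μ φ f) := by
  obtain ⟨hpm, cl, hcl, hlow⟩ := hlow
  obtain ⟨-, cu, hcu, hupp⟩ := hupp
  obtain ⟨q, hq1, hqp, hAq⟩ := MusielakOrlicz.exists_isAq hA hq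
  obtain ⟨C, hC⟩ := MusielakOrlicz.lintegral_dyadicSum_lmax_le hφ hq1 hqp hAq hlow
  have hmod := fun (f : Ω → ℝ) (hf : Measurable f) =>
    MusielakOrlicz.modular_doobMax_le hφ hupp hC hf
  obtain ⟨D, hD, hnorm⟩ := MusielakOrlicz.luxNorm_doobMax_le hpm hlow hmod
  refine ⟨fun f hf => ⟨fun n => ?_, ?_⟩, ⟨D, hD, fun f hf => ⟨⟨?_, ?_⟩, hnorm f hf.1⟩⟩,
    -- The summand 1 only ensures positivity, since C may vanish.
    ⟨cu * 4 ^ pplus * C + 1, by positivity, fun f hf => (hmod f hf.1).trans ?_⟩⟩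
  · filter_upwards [hf.lmax_ae_lt_top hφ hC] with x hx
    exact (le_iSup (fun n => (μ⁻[fun y => ‖f y‖ₑ|ℱ n]) x) n).trans_lt hx
  · filter_upwards [hf.lmax_ae_lt_top hφ hC, MusielakOrlicz.doobMax_le_lmax μ ℱ f] with x hx hle
    exact hle.trans_lt hx
  · exact (MusielakOrlicz.measurable_doobMax μ ℱ f).ennreal_toReal
  · exact (hnorm f hf.1).trans_lt (ENNReal.mul_lt_top ENNReal.coe_lt_top hf.2)
  · gcongr
    exact le_self_add
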